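/- The following are equivalent over $\mathsf{RCA}_0$ (that is, $\mathsf{RCA}_0$ proves their equivalence; by completeness, they hold in the same models of $\mathsf{RCA}_0$, where models may have a nonstandard first-order part and an arbitrary nonempty family of sets as second-order part): 1. $\mathsf{ACA}_0$. 2. For every tree $T$, the set of all leaves of $T$ exists. 3. Parallelized $\mathsf{LPO}$: if $\langle p_i\rangle_{i\in\mathbb N}$ is a sequence of sequences $p_i:\mathbb N\to\mathbb N$ of natural numbers, then there is a function $z:\mathbb N\to\{0,1\}$ such that for each $i$, $z(i)=1$ if and only if $\exists n\,(p_i(n)=0)$. Here, in second order arithmetic, a tree is a set of (codes of) finite sequences of natural numbers that is closed under initial segments, and a leaf of a tree $T$ is a sequence in $T$ that has no proper extension in $T$. -/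

import Mathlib

universe u

namespace SecondOrderArithmetic

/-! ## The language of second order arithmetic

Number variables and set variables are each indexed by the natural numbers. -/

/-- Numerical terms: number variables, `0`, `1`, sums and products. -/
inductive Term : Type
  | var (x : ℕ)
  | zero
  | one
  | add (s t : Term)
  | mul (s t : Term)

/-- The number variables that occur in a term. -/
def Term.vars : Term → Finset ℕ
  | .var x => {x}
  | .zero => ∅
  | .one => ∅
  | .add s t => s.vars ∪ t.vars
  | .mul s t => s.vars ∪ t.vars

/-- Formulas of second order arithmetic. `mem t X` is the atomic formula `t ∈ X`; `all`, `ex`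
quantify over a number variable and `allSet`, `exSet` over a set variable. -/
inductive Formula : Type
  | eq (s t : Term)
  | lt (s t : Term)
  | mem (t : Term) (X : ℕ)
  | neg (φ : Formula)
  | and (φ ψ : Formula)
  | or (φ ψ : Formula)
  | imp (φ ψ : Formula)
  | iff (φ ψ : Formula)
  | all (x : ℕ) (φ : Formula)
  | ex (x : ℕ) (φ : Formula)
  | allSet (X : ℕ) (φ : Formula)
  | exSet (X : ℕ) (φ : Formula)

namespace Formula

/-- The bounded quantifier `∀ x < t, φ`, an abbreviation (used for `x` not occurring in `t`). -/
def ballLt (x : ℕ) (t : Term) (φ : Formula) : Formula := all x (imp (lt (.var x) t) φ)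

/-- The bounded quantifier `∃ x < t, φ`, an abbreviation (used for `x` not occurring in `t`). -/
def bexLt (x : ℕ) (t : Term) (φ : Formula) : Formula := ex x (and (lt (.var x) t) φ)

/-- Bounded quantifier formulas (`Σ⁰₀`): there are no set quantifiers, and all number quantifiers
are bounded. Free set variables are allowed. -/
inductive IsBounded : Formula → Prop
  | eq (s t : Term) : IsBounded (eq s t)
  | lt (s t : Term) : IsBounded (lt s t)
  | mem (t : Term) (X : ℕ) : IsBounded (mem t X)
  | neg {φ : Formula} : IsBounded φ → IsBounded (neg φ)
  | and {φ ψ : Formula} : IsBounded φ → IsBounded ψ → IsBounded (and φ ψ)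
  | or {φ ψ : Formula} : IsBounded φ → IsBounded ψ → IsBounded (or φ ψ)
  | imp {φ ψ : Formula} : IsBounded φ → IsBounded ψ → IsBounded (imp φ ψ)
  | iff {φ ψ : Formula} : IsBounded φ → IsBounded ψ → IsBounded (iff φ ψ)
  | ballLt {x : ℕ} {t : Term} {φ : Formula} :
      x ∉ t.vars → IsBounded φ → IsBounded (ballLt x t φ)
  | bexLt {x : ℕ} {t : Term} {φ : Formula} :
      x ∉ t.vars → IsBounded φ → IsBounded (bexLt x t φ)

/-- `Σ⁰₁` formulas: `∃ x, θ` with `θ` a bounded quantifier formula. -/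
def IsSigma01 (φ : Formula) : Prop := ∃ x θ, IsBounded θ ∧ φ = ex x θ

/-- `Π⁰₁` formulas: `∀ x, θ` with `θ` a bounded quantifier formula. -/
def IsPi01 (φ : Formula) : Prop := ∃ x θ, IsBounded θ ∧ φ = all x θ

/-- Arithmetical formulas: there are no set quantifiers. Free set variables are allowed. -/
def IsArithmetical : Formula → Prop
  | eq _ _ => True
  | lt _ _ => True
  | mem _ _ => True
  | neg φ => φ.IsArithmetical
  | and φ ψ => φ.IsArithmetical ∧ ψ.IsArithmetical
  | or φ ψ => φ.IsArithmetical ∧ ψ.IsArithmetical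
  | imp φ ψ => φ.IsArithmetical ∧ ψ.IsArithmetical
  | iff φ ψ => φ.IsArithmetical ∧ ψ.IsArithmetical
  | all _ φ => φ.IsArithmetical
  | ex _ φ => φ.IsArithmetical
  | allSet _ _ => False
  | exSet _ _ => False

end Formula

/-! ## Structures and satisfaction -/

/-- A structure for the language of second order arithmetic: number variables range over `Num`
(which may be nonstandard), set variables over the nonempty family `sets` of subsets of `Num`. -/
structure Structure where
  Num : Type u
  sets : Set (Set Num)
  sets_nonempty : sets.Nonempty
  zero : Num
  one : Num
  add : Num → Num → Num
  mul : Num → Num → Num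
  lt : Num → Num → Prop

namespace Structure

instance (M : Structure.{u}) : Zero M.Num := ⟨M.zero⟩
instance (M : Structure.{u}) : One M.Num := ⟨M.one⟩
instance (M : Structure.{u}) : Add M.Num := ⟨M.add⟩
instance (M : Structure.{u}) : Mul M.Num := ⟨M.mul⟩
instance (M : Structure.{u}) : LT M.Num := ⟨M.lt⟩

variable (M : Structure.{u})

/-- The value of a term under an assignment of the number variables. -/
def eval (v : ℕ → M.Num) : Term → M.Num
  | .var x => v x
  | .zero => 0
  | .one => 1
  | .add s t => eval v s + eval v t
  | .mul s t => eval v s * eval v t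

/-- `M.Sat φ v V`: the formula `φ` is true in `M` under the assignment `v` of the number variables
and `V` of the set variables. -/
def Sat : Formula → (ℕ → M.Num) → (ℕ → Set M.Num) → Prop
  | .eq s t, v, _ => M.eval v s = M.eval v t
  | .lt s t, v, _ => M.eval v s < M.eval v t
  | .mem t X, v, V => M.eval v t ∈ V X
  | .neg φ, v, V => ¬ Sat φ v V
  | .and φ ψ, v, V => Sat φ v V ∧ Sat ψ v V
  | .or φ ψ, v, V => Sat φ v V ∨ Sat ψ v V
  | .imp φ ψ, v, V => Sat φ v V → Sat ψ v V
  | .iff φ ψ, v, V => (Sat φ v V ↔ Sat ψ v V)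
  | .all x φ, v, V => ∀ a : M.Num, Sat φ (Function.update v x a) V
  | .ex x φ, v, V => ∃ a : M.Num, Sat φ (Function.update v x a) V
  | .allSet X φ, v, V => ∀ A ∈ M.sets, Sat φ v (Function.update V X A)
  | .exSet X φ, v, V => ∃ A ∈ M.sets, Sat φ v (Function.update V X A)

/-! ## The axiom systems `RCA₀` and `ACA₀` -/

/-- The basic axioms of arithmetic. -/
structure BasicAxioms : Prop where
  succ_ne_zero : ∀ n : M.Num, n + 1 ≠ 0
  succ_inj : ∀ m n : M.Num, m + 1 = n + 1 → m = n
  add_zero : ∀ m : M.Num, m + 0 = m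
  add_succ : ∀ m n : M.Num, m + (n + 1) = (m + n) + 1
  mul_zero : ∀ m : M.Num, m * 0 = 0
  mul_succ : ∀ m n : M.Num, m * (n + 1) = m * n + m
  not_lt_zero : ∀ m : M.Num, ¬ m < 0
  lt_succ : ∀ m n : M.Num, m < n + 1 ↔ m < n ∨ m = n

/-- The scheme of `Σ⁰₁` induction; parameters from `M` enter through the assignments `v`, `V`. -/
def Sigma01Induction : Prop :=
  ∀ (φ : Formula) (x : ℕ) (v : ℕ → M.Num) (V : ℕ → Set M.Num),
    φ.IsSigma01 → (∀ i, V i ∈ M.sets) →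
    M.Sat φ (Function.update v x 0) V →
    (∀ n : M.Num, M.Sat φ (Function.update v x n) V → M.Sat φ (Function.update v x (n + 1)) V) →
    ∀ n : M.Num, M.Sat φ (Function.update v x n) V

/-- The scheme of `Δ⁰₁` (recursive) comprehension. -/
def Delta01Comprehension : Prop :=
  ∀ (φ ψ : Formula) (x : ℕ) (v : ℕ → M.Num) (V : ℕ → Set M.Num),
    φ.IsSigma01 → ψ.IsPi01 → (∀ i, V i ∈ M.sets) →
    (∀ n : M.Num, M.Sat φ (Function.update v x n) V ↔ M.Sat ψ (Function.update v x n) V) →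
    ∃ X ∈ M.sets, ∀ n : M.Num, n ∈ X ↔ M.Sat φ (Function.update v x n) V

/-- The induction axiom for sets. -/
def SetInduction : Prop :=
  ∀ X ∈ M.sets, (0 : M.Num) ∈ X → (∀ n : M.Num, n ∈ X → n + 1 ∈ X) → ∀ n : M.Num, n ∈ X

/-- The scheme of arithmetical comprehension. -/
def ArithmeticalComprehension : Prop :=
  ∀ (φ : Formula) (x : ℕ) (v : ℕ → M.Num) (V : ℕ → Set M.Num),
    φ.IsArithmetical → (∀ i, V i ∈ M.sets) →
    ∃ X ∈ M.sets, ∀ n : M.Num, n ∈ X ↔ M.Sat φ (Function.update v x n) V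

/-- `M` is a model of `RCA₀`. -/
structure ModelsRCA0 : Prop where
  basic : M.BasicAxioms
  induction : M.Sigma01Induction
  comprehension : M.Delta01Comprehension

/-- `M` is a model of `ACA₀`. -/
structure ModelsACA0 : Prop where
  basic : M.BasicAxioms
  induction : M.SetInduction
  comprehension : M.ArithmeticalComprehension

/-! ## Pairs, finite sets, finite sequences, functions and trees, inside `M`

All quantifiers below range over the numbers of `M`, so that each notion is the interpretation in
`M` of the usual arithmetical definition. -/

variable {M}

/-- The code `(i, j) = (i + j)² + i` of a pair of numbers. -/
def pair (i j : M.Num) : M.Num := (i + j) * (i + j) + i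

/-- `c` is a triple `((k, m), n)`, a potential code of a finite set. -/
def IsTriple (c : M.Num) : Prop := ∃ k m n : M.Num, c = pair (pair k m) n

/-- `x` belongs to the finite set that the triple `c = ((k, m), n)` describes: `x < k` and
`m (x + 1) + 1` divides `n`. -/
def CodeMem (x c : M.Num) : Prop :=
  ∃ k m n : M.Num, c = pair (pair k m) n ∧ x < k ∧ ∃ q : M.Num, n = q * (m * (x + 1) + 1)

/-- `c` is the code of a finite set: the least of all triples that describe this set. -/
def IsFinsetCode (c : M.Num) : Prop :=
  IsTriple c ∧ ∀ d : M.Num, IsTriple d → (∀ x, CodeMem x d ↔ CodeMem x c) → ¬ d < c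

/-- `s` is (the code of) a finite sequence of length `l`, that is, of a finite set of pairs which is
a function with domain `{i | i < l}`. -/
def IsSeqOfLength (s l : M.Num) : Prop :=
  IsFinsetCode s ∧
  (∀ x, CodeMem x s → ∃ i j : M.Num, x = pair i j) ∧
  (∀ i j k : M.Num, CodeMem (pair i j) s → CodeMem (pair i k) s → j = k) ∧
  ∀ i : M.Num, i < l ↔ ∃ j : M.Num, CodeMem (pair i j) s

/-- `s` is (the code of) a finite sequence of numbers. -/
def IsSeq (s : M.Num) : Prop := ∃ l : M.Num, IsSeqOfLength s l

/-- For finite sequences `s` and `t`: `s` is an initial segment of `t` (possibly `t` itself), that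
is, `t` takes the value `s(i)` at every `i` below the length of `s`. -/
def InitialSegment (s t : M.Num) : Prop :=
  IsSeq s ∧ IsSeq t ∧ ∀ i j : M.Num, CodeMem (pair i j) s → CodeMem (pair i j) t

/-- A tree: a set of finite sequences that is closed under initial segments. -/
def IsTree (T : Set M.Num) : Prop :=
  (∀ s ∈ T, IsSeq s) ∧ ∀ s t : M.Num, t ∈ T → InitialSegment s t → s ∈ T

/-- `s` is a leaf of the tree `T`: an element of `T` that has no proper extension in `T`. -/
def IsLeaf (T : Set M.Num) (s : M.Num) : Prop :=
  s ∈ T ∧ ∀ t ∈ T, InitialSegment s t → t = s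

/-- `f` is a function from `X` to `Y`: a set of pairs in `X × Y` with exactly one value at every
element of `X`. -/
def IsFunction (X Y f : Set M.Num) : Prop :=
  (∀ c ∈ f, ∃ i ∈ X, ∃ j ∈ Y, c = pair i j) ∧ ∀ i ∈ X, ∃! j : M.Num, pair i j ∈ f

/-- The product `X × Y`, as a set of codes of pairs. -/
def prod (X Y : Set M.Num) : Set M.Num := {c | ∃ i ∈ X, ∃ j ∈ Y, c = pair i j}

variable (M)

/-- In `M`, every tree has a leaf set. -/
def LeafSetsExist : Prop :=
  ∀ T ∈ M.sets, IsTree T → ∃ L ∈ M.sets, ∀ s : M.Num, s ∈ L ↔ IsLeaf T s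

/-- In `M`, parallelized LPO holds. A sequence `⟨pᵢ⟩` of sequences of numbers is a function
`p : ℕ × ℕ → ℕ` with `pᵢ(n) = p(i, n)`, so `((i, n), 0) ∈ p` says `pᵢ(n) = 0`;
similarly `(i, 1) ∈ z` says `z(i) = 1`. -/
def ParallelLPO : Prop :=
  ∀ p ∈ M.sets, IsFunction (prod Set.univ Set.univ) Set.univ p →
    ∃ z ∈ M.sets, IsFunction (Set.univ : Set M.Num) {0, 1} z ∧
      ∀ i : M.Num, pair i 1 ∈ z ↔ ∃ n : M.Num, pair (pair i n) 0 ∈ p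

end Structure

end SecondOrderArithmetic

namespace SecondOrderArithmetic

open Filter Function

/-!
Each of the three statements amounts to deciding, uniformly in `n`, an unbounded question
`∃ a, (n, a) ∈ G`. With such projections at hand, arithmetical comprehension follows by induction on
the formula, the assignments of its bound variables being coded as iterated pairs. Conversely, the
sequence `⟨i⟩` is a leaf of the tree of all sequences `s` with `(s 0, s 1) ∈ G` (when both entries
exist) iff `i` is not in the projection of `G`, and LPO for the characteristic functions of the
sections of `G` decides the projection directly.

All sets are obtained by bounded quantifier comprehension. To avoid writing formulas, definability
of a predicate on tuples is a type class. A formula needs named parameters, so definability is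
required along a filter of sequences of parameters that take every prescribed value; finitely many
definable predicates can then share one sequence.
-/

theorem eq_or_eq_of_add_eq_of_mul_eq {R : Type*} [CommSemiring R] [LinearOrder R]
    [IsStrictOrderedRing R] [ExistsAddOfLE R] {a b c d : R} (hadd : a + b = c + d)
    (hmul : a * b = c * d) : c = a ∨ c = b := by
  wlog hac : a ≤ c generalizing a b c d
  · have h := this hadd.symm hmul.symm (le_of_not_ge hac)
    refine h.imp Eq.symm fun h => ?_
    exact add_right_cancel (b := a) (by rw [add_comm b, hadd, h])
  obtain ⟨e, rfl⟩ := exists_add_of_le hac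
  obtain rfl : b = d + e := add_left_cancel (a := a) (by rw [hadd]; ring)
  have hmul' : a * e = d * e := add_left_cancel (a := a * d) (by linear_combination hmul)
  obtain rfl | he := eq_or_ne e 0
  · exact .inl (add_zero a)
  · exact .inr (by rw [mul_right_cancel₀ he hmul'])

/-! ## Formulas and fresh variables -/

theorem Structure.eval_update_of_notMem {M : Structure.{u}} {t : Term} {x : ℕ} (hx : x ∉ t.vars)
    (v : ℕ → M.Num) (a : M.Num) : M.eval (update v x a) t = M.eval v t := by
  induction t with
  | var y =>
    have hy : y ≠ x := fun h => hx (by simp [Term.vars, h])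
    simp only [eval, update_of_ne hy]
  | zero => rfl
  | one => rfl
  | add s t hs ht | mul s t hs ht =>
    simp only [Term.vars, Finset.mem_union, not_or] at hx
    simp only [eval, hs hx.1, ht hx.2]

/-- The number variables that occur, free or bound, in a formula. -/
def Formula.vars : Formula → Finset ℕ
  | eq s t => s.vars ∪ t.vars
  | lt s t => s.vars ∪ t.vars
  | mem t _ => t.vars
  | neg φ => φ.vars
  | and φ ψ => φ.vars ∪ ψ.vars
  | or φ ψ => φ.vars ∪ ψ.vars
  | imp φ ψ => φ.vars ∪ ψ.vars
  | iff φ ψ => φ.vars ∪ ψ.vars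
  | all x φ => insert x φ.vars
  | ex x φ => insert x φ.vars
  | allSet _ φ => φ.vars
  | exSet _ φ => φ.vars

theorem Structure.sat_update_of_notMem {M : Structure.{u}} {φ : Formula} {x : ℕ}
    (hx : x ∉ φ.vars) (v : ℕ → M.Num) (a : M.Num) (V : ℕ → Set M.Num) :
    M.Sat φ (update v x a) V ↔ M.Sat φ v V := by
  induction φ generalizing v V with
  | eq s t | lt s t =>
    simp only [Formula.vars, Finset.mem_union, not_or] at hx
    simp only [Sat, eval_update_of_notMem hx.1, eval_update_of_notMem hx.2]
  | mem t X => simp only [Sat, eval_update_of_notMem hx]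
  | neg φ hφ => simp only [Sat, hφ hx]
  | and φ ψ hφ hψ | or φ ψ hφ hψ | imp φ ψ hφ hψ | iff φ ψ hφ hψ =>
    simp only [Formula.vars, Finset.mem_union, not_or] at hx
    simp only [Sat, hφ hx.1, hψ hx.2]
  | all y φ hφ | ex y φ hφ =>
    simp only [Formula.vars, Finset.mem_insert, not_or] at hx
    simp only [Sat, update_comm hx.1, hφ hx.2]
  | allSet X φ hφ | exSet X φ hφ => simp only [Sat, hφ hx]

theorem Formula.IsBounded.exists_isSigma01 {θ : Formula} (hθ : θ.IsBounded) :
    ∃ φ : Formula, φ.IsSigma01 ∧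
      ∀ (M : Structure.{u}) v V, M.Sat φ v V ↔ M.Sat θ v V := by
  obtain ⟨y, hy⟩ := Infinite.exists_notMem_finset θ.vars
  refine ⟨.ex y θ, ⟨y, θ, hθ, rfl⟩, fun M v V => ?_⟩
  have : Nonempty M.Num := ⟨0⟩
  simp only [Structure.Sat, Structure.sat_update_of_notMem hy, exists_const]

theorem Formula.IsBounded.exists_isPi01 {θ : Formula} (hθ : θ.IsBounded) :
    ∃ φ : Formula, φ.IsPi01 ∧
      ∀ (M : Structure.{u}) v V, M.Sat φ v V ↔ M.Sat θ v V := by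
  obtain ⟨y, hy⟩ := Infinite.exists_notMem_finset θ.vars
  refine ⟨.all y θ, ⟨y, θ, hθ, rfl⟩, fun M v V => ?_⟩
  have : Nonempty M.Num := ⟨0⟩
  simp only [Structure.Sat, Structure.sat_update_of_notMem hy, forall_const]

/-! ## Bounded definability -/

/-- The filter of sets of sequences in `X` that contain every sequence taking certain finitely many
values. A statement about a sequence of parameters that holds eventually along this filter holds as
soon as the parameters it needs occur in the sequence. -/
def enumerations (X : Type u) : Filter (ℕ → X) := ⨅ x, 𝓟 {e | x ∈ Set.range e}

theorem eventually_mem_range {X : Type u} (x : X) : ∀ᶠ e in enumerations X, x ∈ Set.range e :=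
  mem_iInf_of_mem x (mem_principal_self _)

instance {X : Type u} [Nonempty X] : (enumerations X).NeBot := by
  refine (hasBasis_iInf_principal_finite _).neBot_iff.2 fun {s} hs => ?_
  obtain ⟨e, he⟩ := (hs.countable.insert (Classical.arbitrary X)).exists_eq_range
    (Set.insert_nonempty _ s)
  exact ⟨e, Set.mem_iInter₂.2 fun x hx => he.subset (Set.mem_insert_of_mem _ hx)⟩

namespace Structure

variable {M : Structure.{u}} {α β : Type u}

/-- A type of tuples of numbers: a tuple determines, next to a sequence `e` of number parameters, an
assignment of the number variables. Parameter `i` is the value of the variable `2 * i`, and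
coordinate `j < size` is the value of the variable `2 * j + 1`. -/
class Context (M : Structure.{u}) (α : Type u) where
  size : ℕ
  assign : (ℕ → M.Num) → α → ℕ → M.Num
  assign_two_mul : ∀ e a i, assign e a (2 * i) = e i

open Context

instance : Context M PUnit where
  size := 0
  assign e _ i := e (i / 2)
  assign_two_mul e _ i := by rw [Nat.mul_div_cancel_left i two_pos]

instance [Context M α] : Context M (α × M.Num) where
  size := size M α + 1
  assign e p := update (assign e p.1) (2 * size M α + 1) p.2
  assign_two_mul e p i := by rw [update_of_ne (by lia), assign_two_mul]

variable (M) in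
/-- The sequences of number parameters and of set parameters, filtered by their sets of values. -/
def params : Filter ((ℕ → M.Num) × (ℕ → M.sets)) := enumerations M.Num ×ˢ enumerations M.sets

instance : M.params.NeBot :=
  have : Nonempty M.Num := ⟨0⟩
  have : Nonempty M.sets := M.sets_nonempty.to_subtype
  inferInstanceAs (enumerations M.Num ×ˢ enumerations M.sets).NeBot

/-- The function `t` on tuples is the value of a term with parameters. This is a class, so that
instance search finds the term. -/
class TermDefinable (M : Structure.{u}) [Context M α] (t : α → M.Num) : Prop where
  eventually : ∀ᶠ e in M.params, ∃ τ : Term,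
    (∀ j, size M α ≤ j → 2 * j + 1 ∉ τ.vars) ∧ ∀ a, M.eval (assign e.1 a) τ = t a

/-- The relation `P` on tuples is the truth of a bounded quantifier formula with parameters. This is
a class, so that instance search finds the formula. -/
class BoundedDefinable (M : Structure.{u}) [Context M α] (P : α → Prop) : Prop where
  eventually : ∀ᶠ e in M.params, ∃ θ : Formula,
    θ.IsBounded ∧ ∀ a, M.Sat θ (assign e.1 a) (fun i => e.2 i) ↔ P a

/-- The map `π` forgets the last coordinates of a tuple. -/
class ContextProj (M : Structure.{u}) [Context M α] [Context M β] (π : α → β) : Prop where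
  size_le : size M β ≤ size M α
  assign_eq : ∀ e a i, (∀ j, size M β ≤ j → i ≠ 2 * j + 1) →
    assign e (π a) i = (assign e a i : M.Num)

instance [Context M α] : ContextProj M fun a : α => a where
  size_le := le_rfl
  assign_eq _ _ _ _ := rfl

instance [Context M α] [Context M β] (π : α → β × M.Num) [h : ContextProj M π] :
    ContextProj M fun a => (π a).1 where
  size_le := (Nat.le_succ _).trans h.size_le
  assign_eq e a i hi := by
    rw [← h.assign_eq e a i fun j hj => hi j ((Nat.le_succ _).trans hj)]
    exact (update_of_ne (hi _ le_rfl) _ _).symm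

section

variable [Context M α] [Context M β] {s t : α → M.Num} {P Q : α → Prop}

namespace TermDefinable

instance const (c : M.Num) : TermDefinable M fun _ : α => c where
  eventually := by
    filter_upwards [tendsto_fst.eventually (eventually_mem_range c)] with e ⟨i, hi⟩
    refine ⟨.var (2 * i), fun j _ => by simp only [Term.vars, Finset.mem_singleton]; lia,
      fun a => (assign_two_mul e.1 a i).trans hi⟩

instance snd (π : α → β × M.Num) [h : ContextProj M π] : TermDefinable M fun a => (π a).2 where
  eventually := .of_forall fun e => by
    refine ⟨.var (2 * size M β + 1), fun j hj => ?_, fun a => ?_⟩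
    · have : size M β + 1 ≤ j := h.size_le.trans hj
      simp only [Term.vars, Finset.mem_singleton]
      lia
    · exact (h.assign_eq e.1 a _ fun j (hj : size M β + 1 ≤ j) => by lia).symm.trans
        (update_self ..)

instance add [hs : TermDefinable M s] [ht : TermDefinable M t] :
    TermDefinable M fun a => s a + t a where
  eventually := by
    filter_upwards [hs.eventually, ht.eventually] with e ⟨σ, hσ, hs⟩ ⟨τ, hτ, ht⟩
    exact ⟨.add σ τ, fun j hj => by simp [Term.vars, hσ j hj, hτ j hj], fun a => by
      simp only [eval, hs, ht]⟩

instance mul [hs : TermDefinable M s] [ht : TermDefinable M t] :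
    TermDefinable M fun a => s a * t a where
  eventually := by
    filter_upwards [hs.eventually, ht.eventually] with e ⟨σ, hσ, hs⟩ ⟨τ, hτ, ht⟩
    exact ⟨.mul σ τ, fun j hj => by simp [Term.vars, hσ j hj, hτ j hj], fun a => by
      simp only [eval, hs, ht]⟩

instance pair [TermDefinable M s] [TermDefinable M t] :
    TermDefinable M fun a => pair (s a) (t a) :=
  inferInstanceAs (TermDefinable M fun a => (s a + t a) * (s a + t a) + s a)

end TermDefinable

namespace BoundedDefinable

theorem congr (h : BoundedDefinable M P) (hPQ : ∀ a, P a ↔ Q a) : BoundedDefinable M Q :=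
  (funext fun a => propext (hPQ a) : P = Q) ▸ h

instance eq [hs : TermDefinable M s] [ht : TermDefinable M t] :
    BoundedDefinable M fun a => s a = t a where
  eventually := by
    filter_upwards [hs.eventually, ht.eventually] with e ⟨σ, _, hs⟩ ⟨τ, _, ht⟩
    exact ⟨.eq σ τ, .eq σ τ, fun a => by simp only [Sat, hs, ht]⟩

instance lt [hs : TermDefinable M s] [ht : TermDefinable M t] :
    BoundedDefinable M fun a => s a < t a where
  eventually := by
    filter_upwards [hs.eventually, ht.eventually] with e ⟨σ, _, hs⟩ ⟨τ, _, ht⟩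
    exact ⟨.lt σ τ, .lt σ τ, fun a => by simp only [Sat, hs, ht]⟩

instance mem (X : M.sets) [ht : TermDefinable M t] :
    BoundedDefinable M fun a => t a ∈ (X : Set M.Num) where
  eventually := by
    filter_upwards [ht.eventually, tendsto_snd.eventually (eventually_mem_range X)]
      with e ⟨τ, _, ht⟩ ⟨i, hi⟩
    exact ⟨.mem τ i, .mem τ i, fun a => by simp only [Sat, ht, hi]⟩

instance not [hP : BoundedDefinable M P] : BoundedDefinable M fun a => ¬ P a where
  eventually := by
    filter_upwards [hP.eventually] with e ⟨φ, hφ, hP⟩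
    exact ⟨.neg φ, .neg hφ, fun a => by simp only [Sat, hP]⟩

instance and [hP : BoundedDefinable M P] [hQ : BoundedDefinable M Q] :
    BoundedDefinable M fun a => P a ∧ Q a where
  eventually := by
    filter_upwards [hP.eventually, hQ.eventually] with e ⟨φ, hφ, hP⟩ ⟨ψ, hψ, hQ⟩
    exact ⟨.and φ ψ, .and hφ hψ, fun a => by simp only [Sat, hP, hQ]⟩

instance or [BoundedDefinable M P] [BoundedDefinable M Q] :
    BoundedDefinable M fun a => P a ∨ Q a :=
  congr (P := fun a => ¬ (¬ P a ∧ ¬ Q a)) inferInstance fun _ => or_iff_not_and_not.symm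

instance imp [BoundedDefinable M P] [BoundedDefinable M Q] :
    BoundedDefinable M fun a => P a → Q a :=
  congr (P := fun a => ¬ P a ∨ Q a) inferInstance fun _ => imp_iff_not_or.symm

instance iff [BoundedDefinable M P] [BoundedDefinable M Q] :
    BoundedDefinable M fun a => (P a ↔ Q a) :=
  congr (P := fun a => (P a → Q a) ∧ (Q a → P a)) inferInstance fun _ =>
    iff_iff_implies_and_implies.symm

instance existsLt {P : α → M.Num → Prop} [ht : TermDefinable M t]
    [hP : BoundedDefinable M fun p : α × M.Num => P p.1 p.2] :
    BoundedDefinable M fun a => ∃ b < t a, P a b where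
  eventually := by
    filter_upwards [ht.eventually, hP.eventually] with e ⟨τ, hτ, ht⟩ ⟨φ, hφ, hP⟩
    have hx := hτ _ le_rfl
    refine ⟨.bexLt (2 * size M α + 1) τ φ, .bexLt hx hφ, fun a =>
      exists_congr fun b => and_congr ?_ (hP (a, b))⟩
    simp only [Sat, eval_update_of_notMem hx, ht, eval, update_self]

instance forallLt {P : α → M.Num → Prop} [TermDefinable M t]
    [BoundedDefinable M fun p : α × M.Num => P p.1 p.2] :
    BoundedDefinable M fun a => ∀ b < t a, P a b :=
  congr (P := fun a => ¬ ∃ b < t a, ¬ P a b) inferInstance fun _ => by push Not; rfl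

end BoundedDefinable

end

namespace ModelsRCA0

theorem setOf_sat_mem_sets (hM : M.ModelsRCA0) {θ : Formula} (hθ : θ.IsBounded) (x : ℕ)
    (v : ℕ → M.Num) (V : ℕ → M.sets) :
    {n | M.Sat θ (update v x n) fun i => V i} ∈ M.sets := by
  obtain ⟨φ, hφ, hφθ⟩ := hθ.exists_isSigma01
  obtain ⟨ψ, hψ, hψθ⟩ := hθ.exists_isPi01
  obtain ⟨X, hX, h⟩ := hM.comprehension φ ψ x v (fun i => V i) hφ hψ (fun i => (V i).2)
    fun n => (hφθ ..).trans (hψθ ..).symm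
  rwa [show {n | M.Sat θ (update v x n) fun i => V i} = X from
    Set.ext fun n => ((h n).trans (hφθ ..)).symm]

theorem setOf_mem_sets (hM : M.ModelsRCA0) (P : M.Num → Prop)
    [hP : BoundedDefinable M fun p : PUnit × M.Num => P p.2] : {n | P n} ∈ M.sets := by
  obtain ⟨e, θ, hθ, h⟩ := hP.eventually.exists
  rw [show {n | P n} = {n | M.Sat θ (assign e.1 (PUnit.unit, n)) fun i => e.2 i} from
    Set.ext fun n => (h (.unit, n)).symm]
  exact hM.setOf_sat_mem_sets hθ 1 _ e.2

theorem setOf_exists_mem_sets (hM : M.ModelsRCA0) {P Q : M.Num → M.Num → Prop}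
    [hP : BoundedDefinable M fun p : (PUnit × M.Num) × M.Num => P p.1.2 p.2]
    [hQ : BoundedDefinable M fun p : (PUnit × M.Num) × M.Num => Q p.1.2 p.2]
    (hPQ : ∀ a, (∃ b, P a b) ↔ ∀ b, Q a b) : {a | ∃ b, P a b} ∈ M.sets := by
  obtain ⟨e, ⟨φ, hφ, hP⟩, ψ, hψ, hQ⟩ := (hP.eventually.and hQ.eventually).exists
  have hP' : ∀ a, (∃ b, P a b) ↔ M.Sat (.ex 3 φ) (assign e.1 (PUnit.unit, a)) fun i => e.2 i :=
    fun a => exists_congr fun b => (hP ((.unit, a), b)).symm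
  have hQ' : ∀ a, (∀ b, Q a b) ↔ M.Sat (.all 3 ψ) (assign e.1 (PUnit.unit, a)) fun i => e.2 i :=
    fun a => forall_congr' fun b => (hQ ((.unit, a), b)).symm
  obtain ⟨X, hX, h⟩ := hM.comprehension _ _ 1 _ _ ⟨3, φ, hφ, rfl⟩ ⟨3, ψ, hψ, rfl⟩
    (fun i => (e.2 i).2) fun a => (hP' a).symm.trans ((hPQ a).trans (hQ' a))
  rwa [show {a | ∃ b, P a b} = X from Set.ext fun a => (hP' a).trans (h a).symm]

@[elab_as_elim]
theorem bounded_induction (hM : M.ModelsRCA0) {P : M.Num → Prop}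
    [hP : BoundedDefinable M fun p : PUnit × M.Num => P p.2]
    (zero : P 0) (succ : ∀ a, P a → P (a + 1)) (a : M.Num) : P a := by
  obtain ⟨e, θ, hθ, h⟩ := hP.eventually.exists
  obtain ⟨φ, hφ, hφθ⟩ := hθ.exists_isSigma01
  have key : ∀ a, P a ↔ M.Sat φ (assign e.1 (PUnit.unit, a)) fun i => e.2 i :=
    fun a => (h (.unit, a)).symm.trans (hφθ ..).symm
  simp only [key] at zero succ ⊢
  exact hM.induction φ 1 _ _ hφ (fun i => (e.2 i).2) zero succ a

theorem exists_induction (hM : M.ModelsRCA0) {P : M.Num → M.Num → Prop}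
    [hP : BoundedDefinable M fun p : (PUnit × M.Num) × M.Num => P p.1.2 p.2] (zero : ∃ b, P 0 b)
    (succ : ∀ a, (∃ b, P a b) → ∃ b, P (a + 1) b) (a : M.Num) : ∃ b, P a b := by
  obtain ⟨e, θ, hθ, h⟩ := hP.eventually.exists
  have key : ∀ a, (∃ b, P a b) ↔ M.Sat (.ex 3 θ) (assign e.1 (PUnit.unit, a)) fun i => e.2 i :=
    fun a => exists_congr fun b => (h ((.unit, a), b)).symm
  simp only [key] at zero succ ⊢
  exact hM.induction (.ex 3 θ) 1 _ _ ⟨3, θ, hθ, rfl⟩ (fun i => (e.2 i).2) zero succ a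

/-! ## Arithmetic in models of RCA₀ -/

theorem add_assoc (hM : M.ModelsRCA0) (a b c : M.Num) : a + b + c = a + (b + c) := by
  refine hM.bounded_induction ?_ (fun c h => ?_) c
  · simp only [hM.basic.add_zero]
  · simp only [hM.basic.add_succ, h]

theorem zero_add (hM : M.ModelsRCA0) (a : M.Num) : 0 + a = a := by
  refine hM.bounded_induction ?_ (fun a h => ?_) a
  · exact hM.basic.add_zero 0
  · rw [hM.basic.add_succ, h]

theorem succ_add (hM : M.ModelsRCA0) (a b : M.Num) : a + 1 + b = a + b + 1 := by
  refine hM.bounded_induction ?_ (fun b h => ?_) b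
  · simp only [hM.basic.add_zero]
  · simp only [hM.basic.add_succ, h]

theorem add_comm (hM : M.ModelsRCA0) (a b : M.Num) : a + b = b + a := by
  refine hM.bounded_induction ?_ (fun b h => ?_) b
  · rw [hM.basic.add_zero, hM.zero_add]
  · rw [hM.basic.add_succ, hM.succ_add, h]

theorem mul_add (hM : M.ModelsRCA0) (a b c : M.Num) : a * (b + c) = a * b + a * c := by
  refine hM.bounded_induction ?_ (fun c h => ?_) c
  · simp only [hM.basic.add_zero, hM.basic.mul_zero]
  · rw [hM.basic.add_succ, hM.basic.mul_succ, hM.basic.mul_succ, h, hM.add_assoc]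

theorem mul_assoc (hM : M.ModelsRCA0) (a b c : M.Num) : a * b * c = a * (b * c) := by
  refine hM.bounded_induction ?_ (fun c h => ?_) c
  · simp only [hM.basic.mul_zero]
  · rw [hM.basic.mul_succ, hM.basic.mul_succ, hM.mul_add, h]

theorem zero_mul (hM : M.ModelsRCA0) (a : M.Num) : 0 * a = 0 := by
  refine hM.bounded_induction ?_ (fun a h => ?_) a
  · exact hM.basic.mul_zero 0
  · rw [hM.basic.mul_succ, h, hM.basic.add_zero]

theorem succ_mul (hM : M.ModelsRCA0) (a b : M.Num) : (a + 1) * b = a * b + b := by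
  refine hM.bounded_induction ?_ (fun b h => ?_) b
  · simp only [hM.basic.mul_zero, hM.basic.add_zero]
  · rw [hM.basic.mul_succ, hM.basic.mul_succ, h, hM.basic.add_succ, hM.basic.add_succ,
      hM.add_assoc _ b, hM.add_comm b, ← hM.add_assoc]

theorem mul_comm (hM : M.ModelsRCA0) (a b : M.Num) : a * b = b * a := by
  refine hM.bounded_induction ?_ (fun b h => ?_) b
  · rw [hM.basic.mul_zero, hM.zero_mul]
  · rw [hM.basic.mul_succ, hM.succ_mul, h]

theorem mul_one (hM : M.ModelsRCA0) (a : M.Num) : a * 1 = a := by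
  rw [← hM.zero_add 1, hM.basic.mul_succ, hM.basic.mul_zero, hM.zero_add]

theorem add_right_cancel (hM : M.ModelsRCA0) {a b c : M.Num} : a + c = b + c → a = b := by
  refine hM.bounded_induction (fun h => ?_) (fun c ih h => ?_) c
  · rwa [hM.basic.add_zero, hM.basic.add_zero] at h
  · exact ih (hM.basic.succ_inj _ _ (by rwa [hM.basic.add_succ, hM.basic.add_succ] at h))

theorem eq_zero_or_exists_eq_succ (hM : M.ModelsRCA0) (a : M.Num) : a = 0 ∨ ∃ b, a = b + 1 := by
  obtain ⟨b, h⟩ := hM.exists_induction (P := fun a b => a = 0 ∨ a = b + 1) ⟨0, .inl rfl⟩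
    (fun a _ => ⟨a, .inr rfl⟩) a
  exact h.imp_right fun h => ⟨b, h⟩

theorem lt_iff_exists_eq_add_succ (hM : M.ModelsRCA0) {a b : M.Num} :
    a < b ↔ ∃ c, b = a + c + 1 := by
  constructor
  · refine fun hab => Exists.imp (fun c h => h hab)
      (hM.exists_induction (P := fun b c => a < b → b = a + c + 1)
        ⟨0, fun h => (hM.basic.not_lt_zero a h).elim⟩ ?_ b)
    rintro b ⟨c, hc⟩
    by_cases hab : a < b
    · exact ⟨c + 1, fun _ => by rw [hM.basic.add_succ, ← hc hab]⟩
    · refine ⟨0, fun h => ?_⟩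
      rw [((hM.basic.lt_succ a b).1 h).resolve_left hab, hM.basic.add_zero]
  · rintro ⟨c, rfl⟩
    refine hM.bounded_induction ?_ (fun c h => ?_) c
    · exact (hM.basic.lt_succ _ _).2 (.inr (hM.basic.add_zero a).symm)
    · exact (hM.basic.lt_succ _ _).2 (.inl (by rwa [hM.basic.add_succ]))

theorem exists_add_eq_or_add_eq (hM : M.ModelsRCA0) (a b : M.Num) :
    ∃ c, b = a + c ∨ a = b + c := by
  refine hM.exists_induction (P := fun b c => b = a + c ∨ a = b + c)
    ⟨a, .inr (hM.zero_add a).symm⟩ ?_ b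
  rintro b ⟨c, rfl | rfl⟩
  · exact ⟨c + 1, .inl (hM.basic.add_succ _ _).symm⟩
  · obtain rfl | ⟨c, rfl⟩ := hM.eq_zero_or_exists_eq_succ c
    · exact ⟨1, .inl (by rw [hM.basic.add_zero])⟩
    · exact ⟨c, .inr (by rw [hM.basic.add_succ, hM.succ_add])⟩

end ModelsRCA0

variable [hM : Fact M.ModelsRCA0]

noncomputable instance : CommSemiring M.Num where
  nsmul := nsmulRec
  npow := npowRec
  add_assoc := hM.out.add_assoc
  add_comm := hM.out.add_comm
  zero_add := hM.out.zero_add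
  add_zero := hM.out.basic.add_zero
  left_distrib := hM.out.mul_add
  right_distrib a b c := by
    rw [hM.out.mul_comm, hM.out.mul_add, hM.out.mul_comm c, hM.out.mul_comm c]
  zero_mul := hM.out.zero_mul
  mul_zero := hM.out.basic.mul_zero
  mul_assoc := hM.out.mul_assoc
  mul_comm := hM.out.mul_comm
  one_mul a := (hM.out.mul_comm 1 a).trans (hM.out.mul_one a)
  mul_one := hM.out.mul_one

instance : IsCancelAdd M.Num :=
  have : IsRightCancelAdd M.Num := ⟨fun _ _ _ => hM.out.add_right_cancel⟩
  AddCommMagma.IsRightCancelAdd.toIsCancelAdd M.Num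

theorem eq_zero_of_add_eq_zero {a b : M.Num} (h : a + b = 0) : b = 0 := by
  obtain rfl | ⟨c, rfl⟩ := hM.out.eq_zero_or_exists_eq_succ b
  · rfl
  · exact (hM.out.basic.succ_ne_zero _ ((add_assoc a c 1).trans h)).elim

noncomputable instance : LinearOrder M.Num where
  le a b := ∃ c, b = a + c
  le_refl a := ⟨0, (add_zero a).symm⟩
  le_trans a b c := by
    rintro ⟨d, rfl⟩ ⟨e, rfl⟩
    exact ⟨d + e, add_assoc a d e⟩
  le_antisymm a b := by
    rintro ⟨c, rfl⟩ ⟨d, h⟩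
    have hdc : d + c = 0 :=
      add_left_cancel (a := a) (by rw [add_zero, add_comm d, ← add_assoc, ← h])
    rw [eq_zero_of_add_eq_zero hdc, add_zero]
  lt_iff_le_not_ge a b := by
    rw [hM.out.lt_iff_exists_eq_add_succ]
    constructor
    · rintro ⟨c, rfl⟩
      refine ⟨⟨c + 1, add_assoc a c 1⟩, fun ⟨d, h⟩ => hM.out.basic.succ_ne_zero (d + c) ?_⟩
      exact add_left_cancel (a := a) (by rw [add_zero]; nth_rw 2 [h]; ring)
    · rintro ⟨⟨c, rfl⟩, h⟩
      obtain rfl | ⟨d, rfl⟩ := hM.out.eq_zero_or_exists_eq_succ c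
      · exact (h ⟨0, by rw [add_zero, add_zero]⟩).elim
      · exact ⟨d, (add_assoc a d 1).symm⟩
  le_total a b := by
    obtain ⟨c, h | h⟩ := hM.out.exists_add_eq_or_add_eq a b
    exacts [.inl ⟨c, h⟩, .inr ⟨c, h⟩]
  toDecidableLE := Classical.decRel _

instance : CanonicallyOrderedAdd M.Num where
  exists_add_of_le h := h
  le_self_add _ b := ⟨b, rfl⟩
  le_add_self a b := ⟨b, add_comm b a⟩

instance : IsOrderedCancelAddMonoid M.Num :=
  .of_add_lt_add_left fun c a b h => by
    obtain ⟨d, rfl⟩ := hM.out.lt_iff_exists_eq_add_succ.1 h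
    exact hM.out.lt_iff_exists_eq_add_succ.2 ⟨d, by ring⟩

theorem lt_add_one_iff {a b : M.Num} : a < b + 1 ↔ a ≤ b :=
  (hM.out.basic.lt_succ a b).trans le_iff_lt_or_eq.symm

theorem add_one_le_iff {a b : M.Num} : a + 1 ≤ b ↔ a < b := by
  rw [← lt_add_one_iff, add_lt_add_iff_right]

theorem lt_one_iff {a : M.Num} : a < 1 ↔ a = 0 := by
  rw [← zero_add 1, lt_add_one_iff, nonpos_iff_eq_zero]

instance : IsStrictOrderedRing M.Num where
  zero_le_one := zero_le
  exists_pair_ne := ⟨0, 1, fun h => hM.out.basic.succ_ne_zero 0 ((zero_add 1).trans h.symm)⟩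
  mul_lt_mul_of_pos_left a ha b c h := by
    obtain ⟨d, rfl⟩ := hM.out.lt_iff_exists_eq_add_succ.1 h
    obtain ⟨e, rfl⟩ := hM.out.lt_iff_exists_eq_add_succ.1 ha
    exact hM.out.lt_iff_exists_eq_add_succ.2 ⟨d + e * d + e, by ring⟩
  mul_lt_mul_of_pos_right a ha b c h := by
    obtain ⟨d, rfl⟩ := hM.out.lt_iff_exists_eq_add_succ.1 h
    obtain ⟨e, rfl⟩ := hM.out.lt_iff_exists_eq_add_succ.1 ha
    exact hM.out.lt_iff_exists_eq_add_succ.2 ⟨d + e * d + e, by ring⟩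

namespace BoundedDefinable

variable [Context M α] {t : α → M.Num} {P : α → M.Num → Prop} [TermDefinable M t]
  [BoundedDefinable M fun p : α × M.Num => P p.1 p.2]

instance existsLe : BoundedDefinable M fun a => ∃ b ≤ t a, P a b :=
  congr (P := fun a => ∃ b < t a + 1, P a b) inferInstance fun _ => by simp only [lt_add_one_iff]

instance forallLe : BoundedDefinable M fun a => ∀ b ≤ t a, P a b :=
  congr (P := fun a => ∀ b < t a + 1, P a b) inferInstance fun _ => by simp only [lt_add_one_iff]

end BoundedDefinable

theorem exists_least {P : M.Num → Prop} [BoundedDefinable M fun p : PUnit × M.Num => P p.2]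
    (h : ∃ a, P a) : ∃ a, P a ∧ ∀ b < a, ¬ P b := by
  by_contra! hP
  lift {a | P a} to M.sets using hM.out.setOf_mem_sets P with X hX
  have key (a : M.Num) : ∀ b < a, b ∉ (X : Set M.Num) := by
    refine hM.out.bounded_induction (fun b hb => (not_lt_zero hb).elim) (fun a ih b hb hbX => ?_) a
    obtain ⟨c, hcb, hc⟩ := hP b (hX.subset hbX)
    exact ih c (hcb.trans_le (lt_add_one_iff.1 hb)) (hX.superset hc)
  obtain ⟨a, ha⟩ := h
  exact key (a + 1) a (lt_add_one_iff.2 le_rfl) (hX.superset ha)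

/-! ## Pairs and codes of finite sets -/

theorem le_pair_left (i j : M.Num) : i ≤ pair i j := le_add_self

theorem pair_lt_of_add_lt {i j i' j' : M.Num} (h : i + j < i' + j') : pair i j < pair i' j' :=
  calc pair i j ≤ (i + j) * (i + j) + (i + j) := by
        unfold pair
        gcongr
        exact le_self_add
    _ < (i + j) * (i + j) + (i + j) + (i + j + 1) :=
        lt_add_of_pos_right _ (lt_add_one_iff.2 zero_le)
    _ = (i + j + 1) * (i + j + 1) := by ring
    _ ≤ (i' + j') * (i' + j') := by
        have := add_one_le_iff.2 h
        gcongr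
    _ ≤ pair i' j' := le_self_add

theorem pair_inj {i j i' j' : M.Num} : pair i j = pair i' j' ↔ i = i' ∧ j = j' := by
  refine ⟨fun h => ?_, by rintro ⟨rfl, rfl⟩; rfl⟩
  have hs : i + j = i' + j' := by
    by_contra! hs
    exact hs.lt_or_gt.elim (fun hs => (pair_lt_of_add_lt hs).ne h)
      fun hs => (pair_lt_of_add_lt hs).ne h.symm
  have hi : i = i' := by
    rw [pair, pair, hs] at h
    exact add_left_cancel h
  exact ⟨hi, add_left_cancel (hi ▸ hs)⟩

theorem le_pair_right (i j : M.Num) : j ≤ pair i j :=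
  calc j ≤ i + j := le_add_self
    _ ≤ (i + j) * (i + j) := by
        obtain h | ⟨d, h⟩ := hM.out.eq_zero_or_exists_eq_succ (i + j)
        · rw [h]; exact zero_le
        · rw [h]; exact le_mul_of_one_le_left zero_le le_add_self
    _ ≤ pair i j := le_self_add

theorem exists_isBounded_sat_pair {θ : Formula} (hθ : θ.IsBounded) {x y : ℕ} (hxy : x ≠ y) :
    ∃ (z : ℕ) (θ' : Formula), θ'.IsBounded ∧ ∀ (v : ℕ → M.Num) V a b,
      M.Sat θ' (update v z (pair a b)) V ↔ M.Sat θ (update (update v x a) y b) V := by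
  obtain ⟨z, hz⟩ := Infinite.exists_notMem_finset (insert x (insert y θ.vars))
  simp only [Finset.mem_insert, not_or] at hz
  obtain ⟨hzx, hzy, hz⟩ := hz
  have hbound (w : ℕ) (hw : z ≠ w) : w ∉ (Term.add (.var z) .one).vars := by
    simpa [Term.vars] using hw.symm
  let s : Term := .add (.var x) (.var y)
  refine ⟨z, .bexLt x (.add (.var z) .one) (.bexLt y (.add (.var z) .one)
    (.and (.eq (.var z) (.add (.mul s s) (.var x))) θ)),
    .bexLt (hbound x hzx) (.bexLt (hbound y hzy) (.and (.eq _ _) hθ)), fun v V a b => ?_⟩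
  have hpair (c d : M.Num) :
      pair a b = (c + d) * (c + d) + c ↔ a = c ∧ b = d := pair_inj (i' := c) (j' := d)
  simp only [s, Formula.bexLt, Sat, eval, update_self, update_of_ne hzx, update_of_ne hzy,
    update_of_ne hxy, hpair, lt_add_one_iff]
  rw [← sat_update_of_notMem hz (update (update v x a) y b) (pair a b),
    update_comm (Ne.symm hzy), update_comm (Ne.symm hzx)]
  constructor
  · rintro ⟨_, -, _, -, ⟨rfl, rfl⟩, h⟩
    exact h
  · exact fun h => ⟨a, le_pair_left a b, b, le_pair_right a b, ⟨rfl, rfl⟩, h⟩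

theorem exists_pair_mem_iff (R : M.Num → M.Num → Prop)
    [hR : BoundedDefinable M fun p : (PUnit × M.Num) × M.Num => R p.1.2 p.2] :
    ∃ X : M.sets, ∀ a b, pair a b ∈ (X : Set M.Num) ↔ R a b := by
  obtain ⟨e, θ, hθ, h⟩ := hR.eventually.exists
  obtain ⟨z, θ', hθ', h'⟩ := exists_isBounded_sat_pair (M := M) hθ (show 1 ≠ 3 by decide)
  exact ⟨⟨_, hM.out.setOf_sat_mem_sets hθ' z (assign e.1 PUnit.unit) e.2⟩,
    fun a b => (h' ..).trans (h ((.unit, a), b))⟩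

namespace BoundedDefinable

variable [Context M α] {s t : α → M.Num} [TermDefinable M s] [TermDefinable M t]

theorem comp {P : M.Num → Prop} (hP : BoundedDefinable M fun p : PUnit × M.Num => P p.2) :
    BoundedDefinable M fun a => P (t a) :=
  congr (P := fun a => t a ∈ ((⟨_, hM.out.setOf_mem_sets (hP := hP) P⟩ : M.sets) : Set M.Num))
    inferInstance fun _ => Iff.rfl

theorem comp₂ {R : M.Num → M.Num → Prop}
    (hR : BoundedDefinable M fun p : (PUnit × M.Num) × M.Num => R p.1.2 p.2) :
    BoundedDefinable M fun a => R (s a) (t a) :=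
  have ⟨X, hX⟩ := exists_pair_mem_iff (hR := hR) R
  congr (P := fun a => Structure.pair (s a) (t a) ∈ (X : Set M.Num)) inferInstance fun _ => hX _ _

end BoundedDefinable

theorem exists_pair_pair_eq_iff {c : M.Num} {P : M.Num → M.Num → M.Num → Prop} :
    (∃ k m n, c = pair (pair k m) n ∧ P k m n) ↔
      ∃ k ≤ c, ∃ m ≤ c, ∃ n ≤ c, c = pair (pair k m) n ∧ P k m n := by
  constructor
  · rintro ⟨k, m, n, rfl, h⟩
    have hkm : pair k m ≤ pair (pair k m) n := le_pair_left _ n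
    exact ⟨k, (le_pair_left k m).trans hkm, m, (le_pair_right k m).trans hkm,
      n, le_pair_right _ n, rfl, h⟩
  · rintro ⟨k, -, m, -, n, -, h⟩
    exact ⟨k, m, n, h⟩

theorem isTriple_iff {c : M.Num} :
    IsTriple c ↔ ∃ k ≤ c, ∃ m ≤ c, ∃ n ≤ c, c = pair (pair k m) n := by
  simpa only [IsTriple, and_true] using exists_pair_pair_eq_iff (c := c) (P := fun _ _ _ => True)

theorem codeMem_iff {x c : M.Num} : CodeMem x c ↔ ∃ k ≤ c, ∃ m ≤ c, ∃ n ≤ c,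
    c = pair (pair k m) n ∧ x < k ∧ ∃ q ≤ n, n = q * (m * (x + 1) + 1) := by
  have hq (m n : M.Num) : (∃ q, n = q * (m * (x + 1) + 1)) ↔ ∃ q ≤ n, n = q * (m * (x + 1) + 1) :=
    exists_congr fun q => (and_iff_right_of_imp fun h =>
      (le_mul_of_one_le_right zero_le le_add_self).trans_eq h.symm).symm
  simp only [← hq]
  exact exists_pair_pair_eq_iff

theorem lt_of_codeMem {x c : M.Num} (h : CodeMem x c) : x < c := by
  obtain ⟨k, hk, _, _, _, _, _, hx, _⟩ := codeMem_iff.1 h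
  exact hx.trans_le hk

theorem forall_codeMem_iff_codeMem {c d : M.Num} : (∀ x, CodeMem x d ↔ CodeMem x c) ↔
    ∀ x < c + d, (CodeMem x d ↔ CodeMem x c) :=
  ⟨fun h x _ => h x, fun h x => ⟨fun hx => (h x ((lt_of_codeMem hx).trans_le le_add_self)).1 hx,
    fun hx => (h x ((lt_of_codeMem hx).trans_le le_self_add)).2 hx⟩⟩

namespace BoundedDefinable

variable [Context M α] {s t : α → M.Num} [TermDefinable M s] [TermDefinable M t]

instance isTriple : BoundedDefinable M fun a => IsTriple (t a) :=
  comp (congr inferInstance fun _ => isTriple_iff.symm)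

instance codeMem : BoundedDefinable M fun a => CodeMem (s a) (t a) :=
  comp₂ (congr inferInstance fun _ => codeMem_iff.symm)

instance sameCodeMem : BoundedDefinable M fun a => ∀ x, CodeMem x (s a) ↔ CodeMem x (t a) :=
  comp₂ (R := fun d c => ∀ x, CodeMem x d ↔ CodeMem x c)
    (congr inferInstance fun _ => forall_codeMem_iff_codeMem.symm)

instance isFinsetCode : BoundedDefinable M fun a => IsFinsetCode (t a) :=
  comp (congr (P := fun p : PUnit × M.Num =>
      IsTriple p.2 ∧ ∀ d < p.2, IsTriple d → ¬ ∀ x, CodeMem x d ↔ CodeMem x p.2) inferInstance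
    fun _ => and_congr_right fun _ => forall_congr' fun _ =>
      ⟨fun h hT hx hd => h hd hT hx, fun h hd hT hx => h hT hx hd⟩)

end BoundedDefinable

theorem IsFinsetCode.eq {c d : M.Num} (hc : IsFinsetCode c) (hd : IsFinsetCode d)
    (h : ∀ x, CodeMem x c ↔ CodeMem x d) : c = d :=
  le_antisymm (not_lt.1 (hc.2 d hd.1 fun x => (h x).symm)) (not_lt.1 (hd.2 c hc.1 h))

theorem exists_isFinsetCode {c : M.Num} (hc : IsTriple c) :
    ∃ d : M.Num, IsFinsetCode d ∧ ∀ x, CodeMem x d ↔ CodeMem x c := by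
  obtain ⟨d, ⟨hd, hdc⟩, hmin⟩ :=
    exists_least (P := fun d => IsTriple d ∧ ∀ x, CodeMem x d ↔ CodeMem x c) ⟨c, hc, fun _ => .rfl⟩
  exact ⟨d, ⟨hd, fun e he hed hlt => hmin e hlt ⟨he, fun x => (hed x).trans (hdc x)⟩⟩, hdc⟩

theorem mul_add_inj_of_lt {m u v u' v' : M.Num} (hv : v < m) (hv' : v' < m) :
    m * u + v = m * u' + v' ↔ u = u' ∧ v = v' := by
  refine ⟨fun h => ?_, by rintro ⟨rfl, rfl⟩; rfl⟩
  have hlt {u v u' v' : M.Num} (hv : v < m) (hu : u < u') : m * u + v < m * u' + v' :=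
    calc m * u + v < m * u + m := add_lt_add_right hv _
      _ = m * (u + 1) := by ring
      _ ≤ m * u' := by
          have := add_one_le_iff.2 hu
          gcongr
      _ ≤ m * u' + v' := le_self_add
  obtain rfl : u = u' := by
    by_contra! hu
    exact hu.lt_or_gt.elim (fun hu => (hlt hv hu).ne h) fun hu => (hlt hv' hu).ne h.symm
  exact ⟨rfl, add_left_cancel h⟩

theorem eq_or_eq_of_dvd_mul {m a b x : M.Num} (hm : a * b + (a + b) < m) (hx : 1 ≤ x)
    (hxab : x ≤ a + b) (h : m * x + 1 ∣ (m * a + 1) * (m * b + 1)) : x = a ∨ x = b := by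
  -- The cofactor is `m * r + 1`, and comparing digits in base `m` yields `x + r = a + b` and
  -- `x * r = a * b`.
  have hm0 : 0 < m := zero_le.trans_lt hm
  obtain ⟨q, hq⟩ := h
  obtain rfl | ⟨q, rfl⟩ := hM.out.eq_zero_or_exists_eq_succ q
  · rw [mul_zero] at hq
    exact absurd hq (by positivity)
  have hq : m * (m * (a * b) + (a + b)) = m * (x * (q + 1)) + q :=
    add_right_cancel (b := 1) (by linear_combination hq)
  obtain ⟨r, hr⟩ := exists_add_of_le
    (le_of_mul_le_mul_left (hq.symm ▸ le_self_add : m * (x * (q + 1)) ≤ _) hm0)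
  obtain rfl : q = m * r := add_left_cancel (hq.symm.trans (by rw [hr]; ring))
  have hdigits : m * (a * b) + (a + b) = m * (x * r) + (x + r) := hr.trans (by ring)
  have hxr : x * r ≤ a * b := by
    refine lt_add_one_iff.1 (lt_of_mul_lt_mul_left ?_ hm0.le)
    calc m * (x * r) ≤ m * (a * b) + (a + b) := hdigits ▸ le_self_add
      _ < m * (a * b) + m := by
        gcongr
        exact le_add_self.trans_lt hm
      _ = m * (a * b + 1) := by ring
  have hr : r ≤ a * b := (le_mul_of_one_le_left zero_le hx).trans hxr
  obtain ⟨hmul, hadd⟩ := (mul_add_inj_of_lt (le_add_self.trans_lt hm)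
    ((add_comm x r ▸ add_le_add hr hxab).trans_lt hm)).1 hdigits
  exact eq_or_eq_of_add_eq_of_mul_eq hadd hmul

theorem exists_isFinsetCode_pair (a b : M.Num) :
    ∃ c : M.Num, IsFinsetCode c ∧ ∀ x, CodeMem x c ↔ x = a ∨ x = b := by
  let m := (a + 1) * (b + 1) + (a + 1 + (b + 1)) + 1
  let n := (m * (a + 1) + 1) * (m * (b + 1) + 1)
  obtain ⟨c, hc, hmem⟩ := exists_isFinsetCode ⟨a + b + 1, m, n, rfl⟩
  refine ⟨c, hc, fun x => (hmem x).trans ⟨?_, fun hx => ⟨a + b + 1, m, n, rfl, ?_, ?_⟩⟩⟩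
  · rintro ⟨k, m', n', hc, hx, q, hn⟩
    obtain ⟨hkm, rfl⟩ := pair_inj.1 hc
    obtain ⟨rfl, rfl⟩ := pair_inj.1 hkm
    have hxab : x + 1 ≤ a + 1 + (b + 1) := (add_one_le_iff.2 hx).trans ⟨1, by ring⟩
    exact (eq_or_eq_of_dvd_mul (lt_add_one_iff.2 le_rfl) le_add_self hxab
      (Dvd.intro_left q hn.symm)).imp add_right_cancel add_right_cancel
  · rcases hx with rfl | rfl
    exacts [lt_add_one_iff.2 le_self_add, lt_add_one_iff.2 le_add_self]
  · rcases hx with rfl | rfl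
    exacts [⟨m * (b + 1) + 1, mul_comm _ _⟩, ⟨m * (a + 1) + 1, rfl⟩]

/-! ## Finite sequences -/

theorem IsFinsetCode.isSeqOfLength {s l : M.Num} (hs : IsFinsetCode s) {f : M.Num → M.Num}
    (h : ∀ x, CodeMem x s ↔ ∃ i < l, x = pair i (f i)) : IsSeqOfLength s l := by
  have hpair (i j : M.Num) : CodeMem (pair i j) s ↔ i < l ∧ j = f i := by
    simp only [h, pair_inj]
    grind
  refine ⟨hs, fun x hx => ?_, fun i j k hj hk => ?_, fun i => ?_⟩
  · obtain ⟨i, -, hi⟩ := (h x).1 hx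
    exact ⟨i, f i, hi⟩
  · rw [((hpair i j).1 hj).2, ((hpair i k).1 hk).2]
  · simp only [hpair, exists_and_left, exists_eq, and_true]

theorem exists_isSeqOfLength_one (i : M.Num) :
    ∃ s : M.Num, IsSeqOfLength s 1 ∧ CodeMem (pair 0 i) s := by
  obtain ⟨s, hs, hmem⟩ := exists_isFinsetCode_pair (pair 0 i) (pair 0 i)
  refine ⟨s, hs.isSeqOfLength (f := fun _ => i) fun x => (hmem x).trans ?_, (hmem _).2 (.inl rfl)⟩
  simp only [or_self, lt_one_iff, exists_eq_left]

theorem exists_isSeqOfLength_two (i n : M.Num) :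
    ∃ s : M.Num, IsSeqOfLength s (1 + 1) ∧ ∀ x, CodeMem x s ↔ x = pair 0 i ∨ x = pair 1 n := by
  obtain ⟨s, hs, hmem⟩ := exists_isFinsetCode_pair (pair 0 i) (pair 1 n)
  refine ⟨s, hs.isSeqOfLength (f := fun k => if k = 0 then i else n) fun x =>
    (hmem x).trans ?_, hmem⟩
  simp only [lt_add_one_iff, le_iff_lt_or_eq, lt_one_iff, or_and_right, exists_or,
    exists_eq_left, if_true, one_ne_zero, if_false]

theorem IsSeqOfLength.lt {s l i : M.Num} (hs : IsSeqOfLength s l) (hi : i < l) : i < s := by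
  obtain ⟨j, hj⟩ := (hs.2.2.2 i).1 hi
  exact (le_pair_left i j).trans_lt (lt_of_codeMem hj)

theorem isSeqOfLength_iff {s l : M.Num} : IsSeqOfLength s l ↔ IsFinsetCode s ∧
    (∀ x < s, CodeMem x s → ∃ i ≤ x, ∃ j ≤ x, x = pair i j) ∧
    (∀ i < s, ∀ j < s, ∀ k < s, CodeMem (pair i j) s → CodeMem (pair i k) s → j = k) ∧
    ∀ i < s + l, (i < l ↔ ∃ j < s, CodeMem (pair i j) s) := by
  have hi {i j : M.Num} (h : CodeMem (pair i j) s) : i < s :=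
    (le_pair_left i j).trans_lt (lt_of_codeMem h)
  have hj {i j : M.Num} (h : CodeMem (pair i j) s) : j < s :=
    (le_pair_right i j).trans_lt (lt_of_codeMem h)
  have hex (i : M.Num) : (∃ j, CodeMem (pair i j) s) ↔ ∃ j < s, CodeMem (pair i j) s :=
    exists_congr fun j => (and_iff_right_of_imp hj).symm
  refine and_congr_right fun _ => and_congr ⟨fun h x _ hx => ?_, fun h x hx => ?_⟩
    (and_congr ⟨fun h i _ j _ k _ => h i j k, fun h i j k hij hik =>
      h i (hi hij) j (hj hij) k (hj hik) hij hik⟩ ?_)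
  · obtain ⟨i, j, rfl⟩ := h x hx
    exact ⟨i, le_pair_left i j, j, le_pair_right i j, rfl⟩
  · obtain ⟨i, -, j, -, hij⟩ := h x (lt_of_codeMem hx) hx
    exact ⟨i, j, hij⟩
  · simp only [hex]
    refine ⟨fun h i _ => h i, fun h i => ⟨fun hil => (h i (hil.trans_le le_add_self)).1 hil, ?_⟩⟩
    rintro ⟨j, hjs, hij⟩
    exact (h i ((hi hij).trans_le le_self_add)).2 ⟨j, hjs, hij⟩

theorem isSeq_iff {s : M.Num} : IsSeq s ↔ ∃ l ≤ s, IsSeqOfLength s l :=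
  exists_congr fun _ => (and_iff_right_of_imp fun h => le_of_forall_lt fun _ => h.lt).symm

theorem initialSegment_iff {s t : M.Num} : InitialSegment s t ↔ IsSeq s ∧ IsSeq t ∧
    ∀ i < s, ∀ j < s, CodeMem (pair i j) s → CodeMem (pair i j) t :=
  and_congr_right fun _ => and_congr_right fun _ => ⟨fun h i _ j _ => h i j, fun h i j hij =>
    h i ((le_pair_left i j).trans_lt (lt_of_codeMem hij)) j
      ((le_pair_right i j).trans_lt (lt_of_codeMem hij)) hij⟩

namespace BoundedDefinable

variable [Context M α] {s t : α → M.Num} [TermDefinable M s] [TermDefinable M t]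

set_option synthInstance.maxSize 256 in
instance isSeqOfLength : BoundedDefinable M fun a => IsSeqOfLength (s a) (t a) :=
  comp₂ (congr inferInstance fun _ => isSeqOfLength_iff.symm)

instance isSeq : BoundedDefinable M fun a => IsSeq (t a) :=
  comp (congr inferInstance fun _ => isSeq_iff.symm)

instance initialSegment : BoundedDefinable M fun a => InitialSegment (s a) (t a) :=
  comp₂ (congr inferInstance fun _ => initialSegment_iff.symm)

end BoundedDefinable

/-! ## Projections and arithmetical comprehension -/

theorem compl_mem_sets {X : Set M.Num} (hX : X ∈ M.sets) : Xᶜ ∈ M.sets := by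
  lift X to M.sets using hX
  exact hM.out.setOf_mem_sets fun n => n ∉ (X : Set M.Num)

theorem univ_mem_sets : Set.univ ∈ M.sets :=
  (Set.eq_univ_of_forall fun _ => rfl : {n : M.Num | n = n} = Set.univ) ▸
    hM.out.setOf_mem_sets fun n => n = n

theorem prod_mem_sets {X Y : Set M.Num} (hX : X ∈ M.sets) (hY : Y ∈ M.sets) :
    prod X Y ∈ M.sets := by
  lift X to M.sets using hX
  lift Y to M.sets using hY
  convert hM.out.setOf_mem_sets fun c =>
    ∃ i ≤ c, ∃ j ≤ c, i ∈ (X : Set M.Num) ∧ j ∈ (Y : Set M.Num) ∧ c = pair i j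
  ext c
  constructor
  · rintro ⟨i, hi, j, hj, rfl⟩
    exact ⟨i, le_pair_left i j, j, le_pair_right i j, hi, hj, rfl⟩
  · rintro ⟨i, -, j, -, hi, hj, h⟩
    exact ⟨i, hi, j, hj, h⟩

theorem exists_pair_pair_mem_iff (R : M.Num → M.Num → M.Num → Prop)
    [BoundedDefinable M fun p : (((PUnit × M.Num) × M.Num) × M.Num) × M.Num =>
      R p.1.1.2 p.1.2 p.2] :
    ∃ X : M.sets, ∀ a b c, pair (pair a b) c ∈ (X : Set M.Num) ↔ R a b c := by
  refine ⟨⟨_, hM.out.setOf_mem_sets fun n => ∃ a ≤ n, ∃ b ≤ n, ∃ c ≤ n,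
    n = pair (pair a b) c ∧ R a b c⟩, fun a b c => exists_pair_pair_eq_iff.symm.trans ⟨?_, ?_⟩⟩
  · rintro ⟨a', b', c', h, hR⟩
    obtain ⟨hab, rfl⟩ := pair_inj.1 h
    obtain ⟨rfl, rfl⟩ := pair_inj.1 hab
    exact hR
  · exact fun hR => ⟨a, b, c, rfl, hR⟩

variable (M) in
/-- The projection principle: every set of codes of pairs has a set of first components. It is the
hub of the equivalence, since each of the three statements decides an unbounded existential
quantifier. -/
def ProjectionsExist : Prop :=
  ∀ G ∈ M.sets, {n | ∃ a, pair n a ∈ G} ∈ M.sets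

omit hM in
theorem ModelsACA0.projectionsExist (h : M.ModelsACA0) : M.ProjectionsExist := by
  intro G hG
  let s : Term := .add (.var 0) (.var 1)
  obtain ⟨X, hX, h⟩ := h.comprehension (.ex 1 (.mem (.add (.mul s s) (.var 0)) 0)) 0
    (fun _ => 0) (fun _ => G) trivial fun _ => hG
  convert hX
  ext n
  exact ((h n).trans (by simp [s, Sat, eval, pair])).symm

theorem ProjectionsExist.setOf_forall_mem_sets (h : M.ProjectionsExist) {G : Set M.Num}
    (hG : G ∈ M.sets) : {n | ∀ a, pair n a ∈ G} ∈ M.sets := by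
  convert compl_mem_sets (h _ (compl_mem_sets hG)) using 1
  ext n
  exact not_exists_not.symm

/-- The assignments `σ i` depend uniformly on their codes: bounded formulas define sets of codes,
also in the presence of one further number `a` as the value of a variable. -/
def IsUniform {ι : Type u} (code : ι → M.Num) (σ : ι → ℕ → M.Num) : Prop :=
  ∀ (θ : Formula) (V : ℕ → M.sets) (x : ℕ), θ.IsBounded → ∃ X : M.sets, ∀ i a,
    pair (code i) a ∈ (X : Set M.Num) ↔ M.Sat θ (update (σ i) x a) fun n => V n

theorem isUniform_const (v : ℕ → M.Num) : IsUniform (fun _ : PUnit => 0) fun _ => v := by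
  intro θ V x hθ
  lift {a | M.Sat θ (update v x a) fun n => V n} to M.sets using
    hM.out.setOf_sat_mem_sets hθ x v V with Y hY
  obtain ⟨X, hX⟩ := exists_pair_mem_iff fun _ a => a ∈ (Y : Set M.Num)
  exact ⟨X, fun _ a => (hX 0 a).trans (by rw [hY]; rfl)⟩

namespace IsUniform

variable {ι : Type u} {code : ι → M.Num} {σ : ι → ℕ → M.Num}

theorem update (h : IsUniform code σ) (x : ℕ) :
    IsUniform (fun p : ι × M.Num => pair (code p.1) p.2) fun p => update (σ p.1) x p.2 := by
  intro θ V y hθ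
  obtain rfl | hxy := eq_or_ne x y
  · obtain ⟨X, hX⟩ := h θ V x hθ
    obtain ⟨Y, hY⟩ := exists_pair_pair_mem_iff fun c _ a => pair c a ∈ (X : Set M.Num)
    exact ⟨Y, fun p a => by simp only [hY, hX, update_idem]⟩
  · obtain ⟨z, θ', hθ', hsat⟩ := exists_isBounded_sat_pair (M := M) hθ hxy
    obtain ⟨X, hX⟩ := h θ' V z hθ'
    obtain ⟨Y, hY⟩ := exists_pair_pair_mem_iff fun c b a => pair c (pair b a) ∈ (X : Set M.Num)
    exact ⟨Y, fun p a => by simp only [hY, hX, hsat]⟩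

theorem exists_code_mem_iff_of_isBounded (h : IsUniform code σ) {θ : Formula} (hθ : θ.IsBounded)
    (V : ℕ → M.sets) :
    ∃ X : M.sets, ∀ i, code i ∈ (X : Set M.Num) ↔ M.Sat θ (σ i) fun n => V n := by
  obtain ⟨y, hy⟩ := Infinite.exists_notMem_finset θ.vars
  obtain ⟨X, hX⟩ := h θ V y hθ
  exact ⟨⟨_, hM.out.setOf_mem_sets fun c => pair c 0 ∈ (X : Set M.Num)⟩,
    fun i => (hX i 0).trans (sat_update_of_notMem hy ..)⟩

end IsUniform

theorem ProjectionsExist.exists_code_mem_iff (hproj : M.ProjectionsExist) {φ : Formula}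
    (hφ : φ.IsArithmetical) (V : ℕ → M.sets) {ι : Type u} {code : ι → M.Num}
    {σ : ι → ℕ → M.Num} (h : IsUniform code σ) :
    ∃ X : M.sets, ∀ i, code i ∈ (X : Set M.Num) ↔ M.Sat φ (σ i) fun n => V n := by
  induction φ generalizing ι with
  | eq s t => exact h.exists_code_mem_iff_of_isBounded (.eq s t) V
  | lt s t => exact h.exists_code_mem_iff_of_isBounded (.lt s t) V
  | mem t X => exact h.exists_code_mem_iff_of_isBounded (.mem t X) V
  | neg φ ih =>
    obtain ⟨X, hX⟩ := ih hφ h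
    exact ⟨⟨_, compl_mem_sets X.2⟩, fun i => not_congr (hX i)⟩
  | and φ ψ ihφ ihψ =>
    obtain ⟨X, hX⟩ := ihφ hφ.1 h
    obtain ⟨Y, hY⟩ := ihψ hφ.2 h
    exact ⟨⟨_, hM.out.setOf_mem_sets fun c => c ∈ (X : Set M.Num) ∧ c ∈ (Y : Set M.Num)⟩,
      fun i => and_congr (hX i) (hY i)⟩
  | or φ ψ ihφ ihψ =>
    obtain ⟨X, hX⟩ := ihφ hφ.1 h
    obtain ⟨Y, hY⟩ := ihψ hφ.2 h
    exact ⟨⟨_, hM.out.setOf_mem_sets fun c => c ∈ (X : Set M.Num) ∨ c ∈ (Y : Set M.Num)⟩,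
      fun i => or_congr (hX i) (hY i)⟩
  | imp φ ψ ihφ ihψ =>
    obtain ⟨X, hX⟩ := ihφ hφ.1 h
    obtain ⟨Y, hY⟩ := ihψ hφ.2 h
    exact ⟨⟨_, hM.out.setOf_mem_sets fun c => c ∈ (X : Set M.Num) → c ∈ (Y : Set M.Num)⟩,
      fun i => imp_congr (hX i) (hY i)⟩
  | iff φ ψ ihφ ihψ =>
    obtain ⟨X, hX⟩ := ihφ hφ.1 h
    obtain ⟨Y, hY⟩ := ihψ hφ.2 h
    exact ⟨⟨_, hM.out.setOf_mem_sets fun c => (c ∈ (X : Set M.Num) ↔ c ∈ (Y : Set M.Num))⟩,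
      fun i => iff_congr (hX i) (hY i)⟩
  | ex x φ ih =>
    obtain ⟨X, hX⟩ := ih hφ (h.update x)
    exact ⟨⟨_, hproj X X.2⟩, fun i => exists_congr fun a => hX (i, a)⟩
  | all x φ ih =>
    obtain ⟨X, hX⟩ := ih hφ (h.update x)
    exact ⟨⟨_, hproj.setOf_forall_mem_sets X.2⟩, fun i => forall_congr' fun a => hX (i, a)⟩
  | allSet | exSet => exact hφ.elim

theorem ProjectionsExist.modelsACA0 (h : M.ProjectionsExist) : M.ModelsACA0 where
  basic := hM.out.basic
  induction X hX zero succ n := by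
    lift X to M.sets using hX
    exact hM.out.bounded_induction (P := fun n => n ∈ (X : Set M.Num)) zero succ n
  comprehension φ x v V hφ hV := by
    lift V to ℕ → M.sets using hV
    obtain ⟨X, hX⟩ := h.exists_code_mem_iff hφ V ((isUniform_const v).update x)
    exact ⟨_, hM.out.setOf_mem_sets fun n => pair 0 n ∈ (X : Set M.Num), fun n => hX (.unit, n)⟩

/-! ## Leaf sets -/

theorem ProjectionsExist.leafSetsExist (h : M.ProjectionsExist) : M.LeafSetsExist := by
  intro T hT hTree
  lift T to M.sets using hT
  obtain ⟨G, hG⟩ := exists_pair_mem_iff fun s t =>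
    t ∈ (T : Set M.Num) ∧ InitialSegment s t ∧ t ≠ s
  lift {n | ∃ a, pair n a ∈ (G : Set M.Num)} to M.sets using h G G.2 with X hX
  refine ⟨_, hM.out.setOf_mem_sets fun s => s ∈ (T : Set M.Num) ∧ s ∉ (X : Set M.Num),
    fun s => and_congr_right fun _ => ?_⟩
  rw [hX]
  change (¬ ∃ t, _) ↔ _
  simp only [hG]
  push Not
  rfl

theorem IsSeqOfLength.codeMem_iff_of_one {s i x : M.Num} (hs : IsSeqOfLength s 1)
    (hi : CodeMem (pair 0 i) s) : CodeMem x s ↔ x = pair 0 i := by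
  refine ⟨fun hx => ?_, by rintro rfl; exact hi⟩
  obtain ⟨a, b, rfl⟩ := hs.2.1 x hx
  obtain rfl := lt_one_iff.1 ((hs.2.2.2 a).2 ⟨b, hx⟩)
  rw [hs.2.2.1 0 b i hx hi]

/-- The tree of the sequences whose entries `0` and `1`, if both exist, form a pair in `G`. The
sequence `⟨i⟩` is a leaf of it iff `i` is not in the projection of `G`. -/
def pairTree (G : Set M.Num) : Set M.Num :=
  {s | IsSeq s ∧ ∀ i n, CodeMem (pair 0 i) s → CodeMem (pair 1 n) s → pair i n ∈ G}

omit hM in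
theorem isTree_pairTree (G : Set M.Num) : IsTree (pairTree G) :=
  ⟨fun _ hs => hs.1, fun _ _ ht hst => ⟨hst.1, fun i n hi hn =>
    ht.2 i n (hst.2.2 0 i hi) (hst.2.2 1 n hn)⟩⟩

theorem pairTree_mem_sets {G : Set M.Num} (hG : G ∈ M.sets) : pairTree G ∈ M.sets := by
  lift G to M.sets using hG
  convert hM.out.setOf_mem_sets fun s => IsSeq s ∧ ∀ i < s, ∀ n < s,
    CodeMem (pair 0 i) s → CodeMem (pair 1 n) s → pair i n ∈ (G : Set M.Num) using 1
  ext s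
  exact and_congr_right fun _ => ⟨fun h i _ n _ => h i n, fun h i n hi hn =>
    h i ((le_pair_right 0 i).trans_lt (lt_of_codeMem hi)) n
      ((le_pair_right 1 n).trans_lt (lt_of_codeMem hn)) hi hn⟩

theorem isLeaf_pairTree_iff {G : Set M.Num} {s i : M.Num} (hs : IsSeqOfLength s 1)
    (hi : CodeMem (pair 0 i) s) : IsLeaf (pairTree G) s ↔ ∀ n, pair i n ∉ G := by
  have hmem (x : M.Num) : CodeMem x s ↔ x = pair 0 i := hs.codeMem_iff_of_one hi
  constructor
  · intro hleaf n hn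
    obtain ⟨t, ht, htmem⟩ := exists_isSeqOfLength_two i n
    have htree : t ∈ pairTree G := by
      refine ⟨⟨_, ht⟩, fun j k hj hk => ?_⟩
      simp only [htmem, pair_inj, zero_ne_one, one_ne_zero, false_and, or_false, false_or, true_and]
        at hj hk
      rwa [hj, hk]
    obtain rfl := hleaf.2 t htree ⟨⟨1, hs⟩, ⟨_, ht⟩, fun j k hjk =>
      (htmem _).2 (.inl ((hmem _).1 hjk))⟩
    exact one_ne_zero (pair_inj.1 ((hmem _).1 ((htmem (pair 1 n)).2 (.inr rfl)))).1
  · intro hG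
    refine ⟨⟨⟨1, hs⟩, fun j k _ hk => ?_⟩, fun t ht hst => ?_⟩
    · exact (one_ne_zero (pair_inj.1 ((hmem _).1 hk)).1).elim
    obtain ⟨⟨l, hl⟩, hpair⟩ := ht
    have hit : CodeMem (pair 0 i) t := hst.2.2 0 i hi
    have hl1 : l ≤ 1 := by
      by_contra! h
      obtain ⟨n, hn⟩ := (hl.2.2.2 1).1 h
      exact hG n (hpair i n hit hn)
    obtain rfl : l = 1 := hl1.antisymm
      (zero_add (1 : M.Num) ▸ add_one_le_iff.2 ((hl.2.2.2 0).2 ⟨i, hit⟩))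
    exact hl.1.eq hs.1 fun x => (hl.codeMem_iff_of_one hit).trans (hmem x).symm

theorem LeafSetsExist.projectionsExist (h : M.LeafSetsExist) : M.ProjectionsExist := by
  intro G hG
  obtain ⟨L, hL, hLmem⟩ := h _ (pairTree_mem_sets hG) (isTree_pairTree G)
  lift L to M.sets using hL
  have hleaf (i s : M.Num) (hs : IsSeqOfLength s 1 ∧ CodeMem (pair 0 i) s) :
      s ∉ (L : Set M.Num) ↔ ∃ n, pair i n ∈ G := by
    rw [hLmem, isLeaf_pairTree_iff hs.1 hs.2]
    push Not
    rfl
  have hsigma (i : M.Num) : (∃ s, (IsSeqOfLength s 1 ∧ CodeMem (pair 0 i) s) ∧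
      s ∉ (L : Set M.Num)) ↔ ∃ n, pair i n ∈ G :=
    ⟨fun ⟨s, hs, hsL⟩ => (hleaf i s hs).1 hsL,
      fun hn => (exists_isSeqOfLength_one i).imp fun s hs => ⟨hs, (hleaf i s hs).2 hn⟩⟩
  have hpi (i : M.Num) : (∀ s, IsSeqOfLength s 1 ∧ CodeMem (pair 0 i) s →
      s ∉ (L : Set M.Num)) ↔ ∃ n, pair i n ∈ G :=
    ⟨fun hall => have ⟨s, hs⟩ := exists_isSeqOfLength_one i; (hleaf i s hs).1 (hall s hs),
      fun hn s hs => (hleaf i s hs).2 hn⟩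
  exact (Set.ext hsigma : {i | ∃ s, _} = {i | ∃ n, pair i n ∈ G}) ▸
    hM.out.setOf_exists_mem_sets fun i => (hsigma i).trans (hpi i).symm

/-! ## Parallelized LPO -/

open Classical in
theorem exists_isFunction_ite {D X Y : Set M.Num} (hD : D ∈ M.sets) (hX : X ∈ M.sets)
    {a b : M.Num} (ha : a ∈ Y) (hb : b ∈ Y) : ∃ f ∈ M.sets, IsFunction D Y f ∧
      ∀ i ∈ D, ∀ j, pair i j ∈ f ↔ j = if i ∈ X then a else b := by
  lift D to M.sets using hD
  lift X to M.sets using hX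
  let f : Set M.Num := {c | ∃ i ≤ c, i ∈ (D : Set M.Num) ∧
    ((i ∈ (X : Set M.Num) ∧ c = pair i a) ∨ (i ∉ (X : Set M.Num) ∧ c = pair i b))}
  have hf : ∀ i ∈ (D : Set M.Num), ∀ j,
      pair i j ∈ f ↔ j = if i ∈ (X : Set M.Num) then a else b := by
    refine fun i hi j => ⟨?_, fun hj => ⟨i, le_pair_left i j, hi, ?_⟩⟩
    · rintro ⟨i', -, -, ⟨hX, h⟩ | ⟨hX, h⟩⟩ <;> obtain ⟨rfl, rfl⟩ := pair_inj.1 h <;> simp [hX]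
    · by_cases hX : i ∈ (X : Set M.Num) <;> simp [hX, hj]
  refine ⟨f, hM.out.setOf_mem_sets _, ⟨fun c hc => ?_, fun i hi => ?_⟩, hf⟩
  · obtain ⟨i, -, hi, ⟨-, h⟩ | ⟨-, h⟩⟩ := hc
    exacts [⟨i, hi, a, ha, h⟩, ⟨i, hi, b, hb, h⟩]
  · simp only [hf i hi, existsUnique_eq]

theorem ProjectionsExist.parallelLPO (h : M.ProjectionsExist) : M.ParallelLPO := by
  intro p hp _
  lift p to M.sets using hp
  have hX := h _ (hM.out.setOf_mem_sets fun c => pair c 0 ∈ (p : Set M.Num))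
  obtain ⟨z, hz, hfun, hmem⟩ := exists_isFunction_ite univ_mem_sets hX (Y := {0, 1}) (a := 1)
    (b := 0) (.inr rfl) (.inl rfl)
  refine ⟨z, hz, hfun, fun i => (hmem i trivial 1).trans ?_⟩
  simp

theorem ParallelLPO.projectionsExist (h : M.ParallelLPO) : M.ProjectionsExist := by
  intro G hG
  obtain ⟨p, hp, hfun, hpmem⟩ := exists_isFunction_ite (prod_mem_sets univ_mem_sets univ_mem_sets)
    hG (a := 0) (b := 1) (Set.mem_univ _) (Set.mem_univ _)
  obtain ⟨z, hz, -, hzmem⟩ := h p hp hfun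
  lift z to M.sets using hz
  convert hM.out.setOf_mem_sets fun i => pair i 1 ∈ (z : Set M.Num)
  refine .trans (exists_congr fun n => ?_) (hzmem _).symm
  simp [hpmem _ ⟨_, trivial, n, trivial, rfl⟩]

end Structure

end SecondOrderArithmetic

/-- Over `RCA₀` (that is, in every model of `RCA₀`) the following are equivalent: `ACA₀`; every tree
has a leaf set; parallelized LPO. -/
theorem proposition3 (M : SecondOrderArithmetic.Structure.{u}) (hM : M.ModelsRCA0) :
    List.TFAE [M.ModelsACA0, M.LeafSetsExist, M.ParallelLPO] := by
  have : Fact M.ModelsRCA0 := ⟨hM⟩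
  tfae_have 1 → 2 := fun h => h.projectionsExist.leafSetsExist
  tfae_have 2 → 3 := fun h => h.projectionsExist.parallelLPO
  tfae_have 3 → 1 := fun h => h.projectionsExist.modelsACA0
  tfae_finish
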